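/- Let $S^3=\{x\in\mathbb{R}^4:\|x\|=1\}$ be the unit sphere with its standard (round) Riemannian metric $\langle\cdot,\cdot\rangle$ induced from $\mathbb{R}^4$, let $\nabla$ be the gradient, $\Delta=\operatorname{div}\nabla$ the Laplace--Beltrami operator and $\mu$ the Riemannian volume measure of $S^3$, and let $$P\varphi=\Delta^2\varphi+\tfrac12\Delta\varphi-\tfrac{15}{16}\varphi$$ be the Paneitz operator of $S^3$. Let $x_1,\dots,x_4$ denote the coordinate functions of $\mathbb{R}^4$ restricted to $S^3$. If $\chi$ and $\rho$ are positive smooth functions on $S^3$ such that $$P\rho=-\chi\rho^{-7}\quad\text{on }S^3,$$ then $$\int_{S^3}\langle\nabla\chi(x),\nabla x_i\rangle\,\rho(x)^{-6}\,d\mu(x)=0\qquad\text{for } i=1,2,3,4.$$ -/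

import Mathlib

open scoped Manifold ContDiff RealInnerProductSpace

noncomputable section

namespace PaneitzSphere

/-- The Euclidean space `ℝ⁴`. -/
abbrev R4 : Type := EuclideanSpace ℝ (Fin 4)

/-- The unit sphere `S³ ⊂ ℝ⁴`, with Mathlib's smooth structure. -/
abbrev S3 : Type := Metric.sphere (0 : R4) 1

instance finrank_R4 : Fact (Module.finrank ℝ R4 = 3 + 1) := ⟨by simp⟩

/-- The tangent space of `S³` at `x`, realized as the hyperplane `x^⊥` of `ℝ⁴`. It carries the
inner product of `ℝ⁴`; this is the standard (round) metric of `S³`. -/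
abbrev TanPlane (x : S3) : Submodule ℝ R4 := (Submodule.span ℝ {(x : R4)})ᗮ

/-- The differential of the inclusion identifies the abstract tangent space `T_x S³` with the
hyperplane `x^⊥`. -/
def tanEquiv (x : S3) : TangentSpace (𝓡 3) x ≃ₗ[ℝ] TanPlane x :=
  (LinearEquiv.ofInjective (mvfderiv (𝓡 3) (Subtype.val : S3 → R4) x).toLinearMap
    (injective_mvfderiv_subtypeVal_sphere x)).trans
  (LinearEquiv.ofEq _ _ (range_mvfderiv_subtypeVal x))

/-- The differential at `x` of a map `f : S³ → V` into a normed space, as a linear map on the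
hyperplane `x^⊥`. -/
def tanDeriv {V : Type*} [NormedAddCommGroup V] [NormedSpace ℝ V] (f : S3 → V) (x : S3) :
    TanPlane x →ₗ[ℝ] V :=
  (mvfderiv (𝓡 3) f x).toLinearMap ∘ₗ (tanEquiv x).symm.toLinearMap

/-- The gradient of `f` at `x` for the round metric: the Riesz dual of the differential,
`⟨∇f, w⟩ = df(w)` for all tangent vectors `w`. -/
def grad (f : S3 → ℝ) (x : S3) : TanPlane x :=
  (InnerProductSpace.toDual ℝ (TanPlane x)).symm (LinearMap.toContinuousLinearMap (tanDeriv f x))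

/-- The covariant derivative of a tangent vector field `X` on `S³` at `x`, as the endomorphism
`w ↦ ∇_w X` of the tangent space. The Levi-Civita connection of the metric induced from `ℝ⁴` is
the tangential part of the derivative of `X` as an `ℝ⁴`-valued map. -/
def covDeriv (X : ∀ x : S3, TanPlane x) (x : S3) : TanPlane x →ₗ[ℝ] TanPlane x :=
  (TanPlane x).orthogonalProjectionOnto.toLinearMap ∘ₗ tanDeriv (fun y => (X y : R4)) x

/-- The divergence of a tangent vector field: the trace of its covariant derivative. -/
def divergence (X : ∀ x : S3, TanPlane x) (x : S3) : ℝ :=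
  LinearMap.trace ℝ (TanPlane x) (covDeriv X x)

/-- The Laplace-Beltrami operator `Δ = div ∇` of the round `S³`. -/
def laplacian (f : S3 → ℝ) (x : S3) : ℝ := divergence (grad f) x

/-- The Paneitz operator `P = Δ² + (1/2) Δ - 15/16` of the round `S³`. -/
def paneitz (f : S3 → ℝ) (x : S3) : ℝ :=
  laplacian (laplacian f) x + 1 / 2 * laplacian f x - 15 / 16 * f x

/-- The `i`-th coordinate function of `ℝ⁴` restricted to `S³`. -/
def coord (i : Fin 4) (x : S3) : ℝ := (x : R4) i

/-- The surface (Riemannian volume) measure of `S³`, of total mass `4 · |B⁴| = 2π²`. -/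
def surfaceMeasure : MeasureTheory.Measure S3 :=
  (MeasureTheory.volume : MeasureTheory.Measure R4).toSphere

end PaneitzSphere

end

/-! This is a Kazdan-Warner argument. Put u = x_i and Lf = ⟨∇u,∇f⟩ + uf/2. The field ∇u is
conformal, and P is covariant along it: P(Lf) = ⟨∇u,∇Pf⟩ - (7/2)uPf
(`IsFirstHarmonic.framePaneitz_conformal`). Since P is symmetric and ∫⟨∇u,∇g⟩ = 3∫ug, this gives ∫
Lρ·Pρ = -∫ Lρ·Pρ, so the integral vanishes (`integral_conformal_mul_framePaneitz`). One more
integration by parts turns ∫⟨∇u,∇χ⟩ρ⁻⁶ into 6∫ Lρ·χρ⁻⁷ = -6∫ Lρ·Pρ (`integral_gradPair_mul_pow`).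

To make this pure algebra, S³ is parallelized by the left-invariant fields x ↦ xi, xj, xk. In this
frame Δ is a sum of squares (`laplacian_eq`), and integrals of frame derivatives vanish
(`integral_frameDeriv`). Functions on S³ are handled through extensions smooth off the origin of ℝ⁴.
-/

noncomputable section

namespace PaneitzSphere

/-! ### Algebra of a frame of derivations: commutators, covariance, integral identities. -/

section FrameAlgebra

variable {A : Type*} [CommRing A] [Algebra ℝ A]

/-- The sum of squares of three derivations. -/
def sumSq (E : Fin 3 → Derivation ℝ A A) (f : A) : A :=
  E 0 (E 0 f) + E 1 (E 1 f) + E 2 (E 2 f)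

/-- The pairing `∑ (E a u) (E a f)` of the gradients with respect to a frame of derivations. -/
def gradPair (E : Fin 3 → Derivation ℝ A A) (u f : A) : A :=
  E 0 u * E 0 f + E 1 u * E 1 f + E 2 u * E 2 f

/-- The Paneitz operator built from the sum of squares of a frame of derivations. -/
def framePaneitz (E : Fin 3 → Derivation ℝ A A) (f : A) : A :=
  sumSq E (sumSq E f) + (1 / 2 : ℝ) • sumSq E f - (15 / 16 : ℝ) • f

/-- The commutation relations of the left-invariant orthonormal frame of `S³`. -/
structure IsSphereFrame (E : Fin 3 → Derivation ℝ A A) : Prop where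
  comm01 : ∀ f, E 0 (E 1 f) = E 1 (E 0 f) + 2 * E 2 f
  comm12 : ∀ f, E 1 (E 2 f) = E 2 (E 1 f) + 2 * E 0 f
  comm20 : ∀ f, E 2 (E 0 f) = E 0 (E 2 f) + 2 * E 1 f

/-- The second order relations satisfied by the restriction to `S³` of a linear function. -/
structure IsFirstHarmonic (E : Fin 3 → Derivation ℝ A A) (u : A) : Prop where
  sq : ∀ a, E a (E a u) = -u
  e01 : E 0 (E 1 u) = E 2 u
  e10 : E 1 (E 0 u) = -E 2 u
  e12 : E 1 (E 2 u) = E 0 u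
  e21 : E 2 (E 1 u) = -E 0 u
  e20 : E 2 (E 0 u) = E 1 u
  e02 : E 0 (E 2 u) = -E 1 u

variable {E : Fin 3 → Derivation ℝ A A}

theorem sumSq_add (f g : A) : sumSq E (f + g) = sumSq E f + sumSq E g := by
  simp only [sumSq, map_add]; ring

theorem sumSq_sub (f g : A) : sumSq E (f - g) = sumSq E f - sumSq E g := by
  simp only [sumSq, map_sub]; ring

theorem sumSq_smul (c : ℝ) (f : A) : sumSq E (c • f) = c • sumSq E f := by
  simp only [sumSq, Derivation.map_smul, smul_add]

theorem sumSq_mul (f g : A) :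
    sumSq E (f * g) = sumSq E f * g + 2 * gradPair E f g + f * sumSq E g := by
  simp only [sumSq, gradPair, Derivation.leibniz, map_add, smul_eq_mul]; ring

/-- The sum of squares is the Casimir element of su(2), hence central. -/
theorem IsSphereFrame.sumSq_comm (hE : IsSphereFrame E) (a : Fin 3) (f : A) :
    sumSq E (E a f) = E a (sumSq E f) := by
  have h01 := hE.comm01; have h12 := hE.comm12; have h20 := hE.comm20
  have two : ∀ (b : Fin 3) (g : A), E b (2 * g) = 2 * E b g := fun b g => by
    rw [two_mul, map_add, two_mul]
  fin_cases a
  · simp only [sumSq, map_add, Fin.zero_eta, h01, h20, two]; ring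
  · simp only [sumSq, map_add, Fin.mk_one, h01, h12, two]; ring
  · simp only [sumSq, map_add, Fin.reduceFinMk, h12, h20, two]; ring

theorem IsFirstHarmonic.sumSq_eq {u : A} (hu : IsFirstHarmonic E u) :
    sumSq E u = -(3 * u) := by
  simp only [sumSq, hu.sq]; ring

theorem IsFirstHarmonic.sumSq_mul {u : A} (hu : IsFirstHarmonic E u) (f : A) :
    sumSq E (u * f) = -(3 * (u * f)) + 2 * gradPair E u f + u * sumSq E f := by
  rw [PaneitzSphere.sumSq_mul, hu.sumSq_eq]; ring

/-- In the product rule, Δ(E a u) = -3 E a u contributes -3⟨∇u,∇f⟩. The diagonal second-order terms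
give -2uΔf; the off-diagonal ones pair into commutators and give +4⟨∇u,∇f⟩. -/
theorem IsFirstHarmonic.sumSq_gradPair {u : A} (hE : IsSphereFrame E)
    (hu : IsFirstHarmonic E u) (f : A) :
    sumSq E (gradPair E u f) = gradPair E u (sumSq E f) + gradPair E u f - 2 * (u * sumSq E f) := by
  have key : ∀ a, sumSq E (E a u) = -(3 * E a u) := fun a => by
    rw [hE.sumSq_comm, hu.sumSq_eq, map_neg, show (3 : A) * u = u + u + u by ring]
    simp only [map_add]; ring
  have h : ∀ a, sumSq E (E a u * E a f) =
      -(3 * E a u) * E a f + 2 * gradPair E (E a u) (E a f) + E a u * E a (sumSq E f) :=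
    fun a => by rw [PaneitzSphere.sumSq_mul, key, hE.sumSq_comm]
  rw [gradPair, sumSq_add, sumSq_add, h, h, h]
  simp only [gradPair, hu.sq, hu.e01, hu.e10, hu.e12, hu.e21, hu.e20, hu.e02,
    hE.comm01 f, hE.comm12 f, hE.comm20 f]
  rw [show sumSq E f = E 0 (E 0 f) + E 1 (E 1 f) + E 2 (E 2 f) from rfl]
  ring

theorem gradPair_add (u f g : A) : gradPair E u (f + g) = gradPair E u f + gradPair E u g := by
  simp only [gradPair, map_add]; ring

theorem gradPair_sub (u f g : A) : gradPair E u (f - g) = gradPair E u f - gradPair E u g := by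
  simp only [gradPair, map_sub]; ring

theorem gradPair_smul (c : ℝ) (u f : A) : gradPair E u (c • f) = c • gradPair E u f := by
  simp only [gradPair, Derivation.map_smul, mul_smul_comm, smul_add]

theorem gradPair_mul (u f g : A) :
    gradPair E u (f * g) = f * gradPair E u g + gradPair E u f * g := by
  simp only [gradPair, Derivation.leibniz, smul_eq_mul]; ring

/-- Infinitesimal conformal covariance of the Paneitz operator along `∇u`. -/
theorem IsFirstHarmonic.framePaneitz_conformal {u : A} (hE : IsSphereFrame E)
    (hu : IsFirstHarmonic E u) (f : A) :
    -- With n = 3 and div ∇u / n = -u, the coefficients 1/2 and -7/2 are -u times the conformal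
    -- weights (n-4)/2 and (n+4)/2.
    framePaneitz E (gradPair E u f + (1 / 2 : ℝ) • (u * f)) =
      gradPair E u (framePaneitz E f) - (7 / 2 : ℝ) • (u * framePaneitz E f) := by
  have three : ∀ g : A, 3 * g = (3 : ℝ) • g := fun g => by
    rw [Algebra.smul_def, map_ofNat]
  have two : ∀ g : A, 2 * g = (2 : ℝ) • g := fun g => by
    rw [Algebra.smul_def, map_ofNat]
  have hX : ∀ g, sumSq E (gradPair E u g) =
      gradPair E u (sumSq E g) + gradPair E u g - (2 : ℝ) • (u * sumSq E g) := fun g => by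
    rw [hu.sumSq_gradPair hE, two]
  have hM : ∀ g, sumSq E (u * g) =
      -((3 : ℝ) • (u * g)) + (2 : ℝ) • gradPair E u g + u * sumSq E g := fun g => by
    rw [hu.sumSq_mul, two, three]
  have hneg : ∀ g, sumSq E (-g) = - sumSq E g := fun g => by
    simp only [sumSq, map_neg]; ring
  simp only [framePaneitz, sumSq_add, sumSq_sub, sumSq_smul, hX, hM, hneg, gradPair_add,
    gradPair_sub, gradPair_smul, mul_add, mul_sub, mul_smul_comm]
  module

variable {I : A →ₗ[ℝ] ℝ}

/-- Green's identity: the two integrands add up to a sum of frame derivatives. -/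
theorem integral_mul_sumSq (hI : ∀ a f, I (E a f) = 0) (f g : A) :
    I (f * sumSq E g) = -I (gradPair E f g) := by
  have h : f * sumSq E g + gradPair E f g =
      E 0 (f * E 0 g) + E 1 (f * E 1 g) + E 2 (f * E 2 g) := by
    simp only [sumSq, gradPair, Derivation.leibniz, smul_eq_mul]; ring
  have h' := congrArg I h
  simp only [map_add, hI] at h'
  linarith

theorem integral_sumSq_symm (hI : ∀ a f, I (E a f) = 0) (f g : A) :
    I (f * sumSq E g) = I (sumSq E f * g) := by
  rw [mul_comm (sumSq E f), integral_mul_sumSq hI, integral_mul_sumSq hI]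
  congr 2; simp only [gradPair]; ring

theorem integral_framePaneitz_symm (hI : ∀ a f, I (E a f) = 0) (f g : A) :
    I (f * framePaneitz E g) = I (framePaneitz E f * g) := by
  simp only [framePaneitz, mul_add, mul_sub, add_mul, sub_mul, mul_smul_comm, smul_mul_assoc,
    map_add, map_sub, map_smul]
  rw [integral_sumSq_symm hI f g, integral_sumSq_symm hI f, integral_sumSq_symm hI _ g]

theorem integral_gradPair (hI : ∀ a f, I (E a f) = 0) {u : A} (hu : IsFirstHarmonic E u) (f : A) :
    I (gradPair E u f) = 3 * I (u * f) := by
  have h1 := integral_mul_sumSq hI f u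
  have h2 : gradPair E f u = gradPair E u f := by simp only [gradPair]; ring
  rw [hu.sumSq_eq, h2, show f * -(3 * u) = -((3 : ℝ) • (u * f)) by
    rw [Algebra.smul_def, map_ofNat]; ring, map_neg, map_smul, smul_eq_mul] at h1
  linarith

/-- The Pohozaev-type identity behind the Kazdan-Warner condition. -/
theorem integral_conformal_mul_framePaneitz (hI : ∀ a f, I (E a f) = 0) (hE : IsSphereFrame E)
    {u : A} (hu : IsFirstHarmonic E u) (r : A) :
    I ((gradPair E u r + (1 / 2 : ℝ) • (u * r)) * framePaneitz E r) = 0 := by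
  have h1 := integral_framePaneitz_symm hI r (gradPair E u r + (1 / 2 : ℝ) • (u * r))
  rw [hu.framePaneitz_conformal hE] at h1
  have h2 := integral_gradPair hI hu (r * framePaneitz E r)
  rw [gradPair_mul] at h2
  set p := framePaneitz E r
  simp only [mul_sub, mul_add, add_mul, mul_smul_comm, smul_mul_assoc, map_add, map_sub,
    map_smul, smul_eq_mul] at h1 h2 ⊢
  rw [show r * (u * p) = u * (r * p) by ring, mul_comm p (gradPair E u r),
    show p * (u * r) = u * (r * p) by ring] at h1
  rw [show u * r * p = u * (r * p) by ring]
  linarith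

theorem integral_gradPair_mul_pow (hI : ∀ a f, I (E a f) = 0) {u : A}
    (hu : IsFirstHarmonic E u) (c : A) {r s : A} (hrs : r * s = 1) :
    I (gradPair E u c * s ^ 6) =
      6 * I ((gradPair E u r + (1 / 2 : ℝ) • (u * r)) * (c * s ^ 7)) := by
  -- Differentiate r s = 1 and multiply by s.
  have hs : ∀ a, E a s = -(s ^ 2 * E a r) := fun a => by
    have h := congrArg (E a) hrs
    rw [Derivation.leibniz, Derivation.map_one_eq_zero, smul_eq_mul, smul_eq_mul] at h
    linear_combination s * h - E a s * hrs
  have hpow : gradPair E u (s ^ 6) = (-6 : ℝ) • (gradPair E u r * s ^ 7) := by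
    simp only [gradPair, Derivation.leibniz_pow, hs, smul_eq_mul, Algebra.smul_def, map_neg,
      map_ofNat]
    ring
  have h := integral_gradPair hI hu (c * s ^ 6)
  rw [gradPair_mul, hpow, mul_smul_comm, map_add, map_smul, smul_eq_mul] at h
  simp only [add_mul, smul_mul_assoc, map_add, map_smul, smul_eq_mul]
  rw [show u * r * (c * s ^ 7) = u * (c * s ^ 6) by linear_combination u * c * s ^ 6 * hrs,
    show gradPair E u r * (c * s ^ 7) = c * (gradPair E u r * s ^ 7) by ring]
  linarith

end FrameAlgebra

/-! ### The quaternionic orthonormal frame of S³. -/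

section Quaternions

/-- Right multiplication by the quaternion units `i`, `j`, `k` on `ℝ⁴`. -/
def rightMul (a : Fin 3) : R4 →L[ℝ] R4 :=
  LinearMap.toContinuousLinearMap
    { toFun := fun x => (![!₂[-x 1, x 0, x 3, -x 2], !₂[-x 2, -x 3, x 0, x 1],
        !₂[-x 3, x 2, -x 1, x 0]] : Fin 3 → R4) a
      map_add' := fun x y => by
        fin_cases a <;> ext k <;> fin_cases k <;> simp <;> ring
      map_smul' := fun c x => by
        fin_cases a <;> ext k <;> fin_cases k <;> simp }

theorem rightMul_zero_apply (x : R4) : rightMul 0 x = !₂[-x 1, x 0, x 3, -x 2] := rfl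

theorem rightMul_one_apply (x : R4) : rightMul 1 x = !₂[-x 2, -x 3, x 0, x 1] := rfl

theorem rightMul_two_apply (x : R4) : rightMul 2 x = !₂[-x 3, x 2, -x 1, x 0] := rfl

theorem rightMul_sq (a : Fin 3) (x : R4) : rightMul a (rightMul a x) = -x := by
  fin_cases a <;> ext k <;> fin_cases k <;>
    simp [rightMul_zero_apply, rightMul_one_apply, rightMul_two_apply]

theorem rightMul_one_zero (x : R4) : rightMul 1 (rightMul 0 x) = rightMul 2 x := by
  ext k; fin_cases k <;> simp [rightMul_zero_apply, rightMul_one_apply, rightMul_two_apply]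

theorem rightMul_zero_one (x : R4) : rightMul 0 (rightMul 1 x) = -rightMul 2 x := by
  ext k; fin_cases k <;> simp [rightMul_zero_apply, rightMul_one_apply, rightMul_two_apply]

theorem rightMul_two_one (x : R4) : rightMul 2 (rightMul 1 x) = rightMul 0 x := by
  ext k; fin_cases k <;> simp [rightMul_zero_apply, rightMul_one_apply, rightMul_two_apply]

theorem rightMul_one_two (x : R4) : rightMul 1 (rightMul 2 x) = -rightMul 0 x := by
  ext k; fin_cases k <;> simp [rightMul_zero_apply, rightMul_one_apply, rightMul_two_apply]

theorem rightMul_zero_two (x : R4) : rightMul 0 (rightMul 2 x) = rightMul 1 x := by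
  ext k; fin_cases k <;> simp [rightMul_zero_apply, rightMul_one_apply, rightMul_two_apply]

theorem rightMul_two_zero (x : R4) : rightMul 2 (rightMul 0 x) = -rightMul 1 x := by
  ext k; fin_cases k <;> simp [rightMul_zero_apply, rightMul_one_apply, rightMul_two_apply]

theorem inner_rightMul_left (a : Fin 3) (x y : R4) :
    ⟪rightMul a x, y⟫ = -⟪x, rightMul a y⟫ := by
  fin_cases a <;>
    simp [rightMul_zero_apply, rightMul_one_apply, rightMul_two_apply, PiLp.inner_apply,
      Fin.sum_univ_four] <;> ring

theorem inner_self_rightMul (a : Fin 3) (x : R4) : ⟪x, rightMul a x⟫ = 0 := by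
  have h := inner_rightMul_left a x x
  rw [real_inner_comm] at h
  linarith

theorem inner_rightMul_rightMul (a b : Fin 3) (x : R4) :
    ⟪rightMul a x, rightMul b x⟫ = if a = b then ⟪x, x⟫ else 0 := by
  rw [inner_rightMul_left]
  fin_cases a <;> fin_cases b <;>
    simp [rightMul_sq, rightMul_one_zero, rightMul_zero_one, rightMul_two_one, rightMul_one_two,
      rightMul_zero_two, rightMul_two_zero, inner_self_rightMul]

theorem rightMul_mem_tanPlane (a : Fin 3) (x : S3) : rightMul a (x : R4) ∈ TanPlane x :=
  Submodule.mem_orthogonal_singleton_iff_inner_right.2 (inner_self_rightMul a _)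

/-- The left-invariant frame of `S³`. -/
def frameVec (x : S3) (a : Fin 3) : TanPlane x := ⟨rightMul a x, rightMul_mem_tanPlane a x⟩

theorem orthonormal_frameVec (x : S3) : Orthonormal ℝ (frameVec x) := by
  rw [orthonormal_iff_ite]
  intro a b
  rw [Submodule.coe_inner]
  simp only [frameVec]
  rw [inner_rightMul_rightMul, real_inner_self_eq_norm_sq, norm_eq_of_mem_sphere]
  simp

theorem finrank_tanPlane (x : S3) : Module.finrank ℝ (TanPlane x) = 3 :=
  Submodule.finrank_orthogonal_span_singleton (ne_zero_of_mem_unit_sphere x)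

/-- The left-invariant frame as an orthonormal basis of the tangent space. -/
def frame (x : S3) : OrthonormalBasis (Fin 3) ℝ (TanPlane x) :=
  OrthonormalBasis.mk (orthonormal_frameVec x) (by
    rw [(orthonormal_frameVec x).linearIndependent.span_eq_top_of_card_eq_finrank' (by
      rw [finrank_tanPlane, Fintype.card_fin])])

theorem coe_frame (x : S3) (a : Fin 3) : (frame x a : R4) = rightMul a x := by
  simp [frame, frameVec]

end Quaternions

/-! ### Gradient and Laplacian on S³ computed from ambient extensions. -/

section Extensions

theorem tanDeriv_eq {V : Type*} [NormedAddCommGroup V] [NormedSpace ℝ V] {f : S3 → V} {F : R4 → V}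
    (hf : ∀ x : S3, f x = F x) {x : S3} (hF : DifferentiableAt ℝ F x) (w : TanPlane x) :
    tanDeriv f x w = fderiv ℝ F x w := by
  have hfF : f = F ∘ (Subtype.val : S3 → R4) := funext hf
  have hval : MDifferentiableAt (𝓡 3) 𝓘(ℝ, R4) (Subtype.val : S3 → R4) x :=
    (contMDiff_coe_sphere (m := 1)).mdifferentiableAt one_ne_zero
  have hw : mvfderiv (𝓡 3) (Subtype.val : S3 → R4) x ((tanEquiv x).symm w) = (w : R4) := by
    conv_rhs => rw [← (tanEquiv x).apply_symm_apply w]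
    rfl
  have h : tanDeriv f x w = mvfderiv (𝓡 3) f x ((tanEquiv x).symm w) := rfl
  rw [h, hfF, ← hw]
  have hcomp := mfderiv_comp_apply (I := 𝓡 3) (I' := 𝓘(ℝ, R4)) (I'' := 𝓘(ℝ, V)) (x : S3)
    (g := F) (f := (Subtype.val : S3 → R4)) hF.mdifferentiableAt hval ((tanEquiv x).symm w)
  rw [mfderiv_eq_fderiv] at hcomp
  exact hcomp

/-- The derivative of a function on `ℝ⁴` along a field of the left-invariant frame. -/
def frameDeriv (a : Fin 3) (F : R4 → ℝ) (y : R4) : ℝ := fderiv ℝ F y (rightMul a y)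

theorem inner_grad {f : S3 → ℝ} {F : R4 → ℝ} (hf : ∀ x : S3, f x = F x) {x : S3}
    (hF : DifferentiableAt ℝ F x) (w : TanPlane x) : ⟪grad f x, w⟫ = fderiv ℝ F x w := by
  rw [grad, InnerProductSpace.toDual_symm_apply]
  exact tanDeriv_eq hf hF w

theorem grad_eq {f : S3 → ℝ} {F : R4 → ℝ} (hf : ∀ x : S3, f x = F x) {x : S3}
    (hF : DifferentiableAt ℝ F x) : grad f x = ∑ a, frameDeriv a F x • frame x a := by
  conv_lhs => rw [← (frame x).sum_repr' (grad f x)]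
  refine Finset.sum_congr rfl fun a _ => ?_
  rw [real_inner_comm, inner_grad hf hF, coe_frame, frameDeriv]

theorem inner_grad_grad {f g : S3 → ℝ} {F G : R4 → ℝ} (hf : ∀ x : S3, f x = F x)
    (hg : ∀ x : S3, g x = G x) {x : S3}
    (hF : DifferentiableAt ℝ F x) (hG : DifferentiableAt ℝ G x) :
    ⟪grad f x, grad g x⟫ = ∑ a, frameDeriv a F x * frameDeriv a G x := by
  rw [grad_eq hg hG, inner_sum]
  refine Finset.sum_congr rfl fun a _ => ?_
  rw [inner_smul_right, inner_grad hf hF, coe_frame, frameDeriv, mul_comm, ← frameDeriv]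

/-- Functions on `ℝ⁴` that are smooth away from the origin. -/
def smoothOff : Subalgebra ℝ (R4 → ℝ) where
  carrier := {F | ContDiffOn ℝ ∞ F {0}ᶜ}
  mul_mem' hf hg := ContDiffOn.mul hf hg
  add_mem' hf hg := ContDiffOn.add hf hg
  algebraMap_mem' _ := contDiffOn_const

theorem contDiffAt_of_mem {F : R4 → ℝ} (hF : F ∈ smoothOff) {y : R4} (hy : y ≠ 0) :
    ContDiffAt ℝ ∞ F y :=
  ContDiffOn.contDiffAt hF (isOpen_compl_singleton.mem_nhds hy)

theorem differentiableAt_of_mem {F : R4 → ℝ} (hF : F ∈ smoothOff) {y : R4} (hy : y ≠ 0) :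
    DifferentiableAt ℝ F y :=
  (contDiffAt_of_mem hF hy).differentiableAt (by simp)

theorem frameDeriv_mem (a : Fin 3) {F : R4 → ℝ} (hF : F ∈ smoothOff) :
    frameDeriv a F ∈ smoothOff := by
  have h : ContDiffOn ℝ ∞ (fderiv ℝ F) {0}ᶜ :=
    ContDiffOn.fderiv_of_isOpen hF isOpen_compl_singleton (by simp)
  exact h.clm_apply (rightMul a).contDiff.contDiffOn

/-- The fields vanish at the origin, so identities between frame derivatives survive there, although
F need not be differentiable at 0. -/
theorem frameDeriv_at_zero (a : Fin 3) (F : R4 → ℝ) : frameDeriv a F 0 = 0 := by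
  simp [frameDeriv]

/-- No first-order term appears because the frame fields are divergence free: each `rightMul a` is
skew, so ⟨w, `rightMul a` w⟩ = 0. -/
theorem laplacian_eq {f : S3 → ℝ} {F : R4 → ℝ} (hf : ∀ x : S3, f x = F x) (hF : F ∈ smoothOff)
    (x : S3) : laplacian f x = ∑ a, frameDeriv a (frameDeriv a F) x := by
  have hx : (x : R4) ≠ 0 := ne_zero_of_mem_unit_sphere x
  rw [laplacian, divergence, LinearMap.trace_eq_sum_inner _ (frame x)]
  refine Finset.sum_congr rfl fun b _ => ?_
  have hd : ∀ a, DifferentiableAt ℝ (frameDeriv a F) x := fun a =>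
    differentiableAt_of_mem (frameDeriv_mem a hF) hx
  have hG : ∀ y : S3, ((grad f y : TanPlane y) : R4) =
      (fun z : R4 => ∑ a, frameDeriv a F z • rightMul a z) y := fun y => by
    rw [grad_eq hf (differentiableAt_of_mem hF (ne_zero_of_mem_unit_sphere y))]
    simp [coe_frame]
  have hcov : covDeriv (grad f) x (frame x b) = (TanPlane x).orthogonalProjectionOnto
      (tanDeriv (fun y => ((grad f y : TanPlane y) : R4)) x (frame x b)) := rfl
  have hsm : ∀ a, HasFDerivAt (fun z : R4 => frameDeriv a F z • rightMul a z)
      (frameDeriv a F x • rightMul a +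
        (fderiv ℝ (frameDeriv a F) x).smulRight (rightMul a x)) (x : R4) := fun a =>
    (hd a).hasFDerivAt.smul (rightMul a).hasFDerivAt
  have hsum := HasFDerivAt.fun_sum (u := Finset.univ) fun a _ => hsm a
  rw [hcov, Submodule.inner_orthogonalProjectionOnto_eq_of_mem_left,
    tanDeriv_eq hG hsum.differentiableAt, hsum.fderiv, coe_frame]
  simp only [_root_.sum_apply, _root_.add_apply,
    _root_.smul_apply, ContinuousLinearMap.smulRight_apply, inner_sum,
    inner_add_right, inner_smul_right]
  rw [Finset.sum_eq_single b]
  · rw [inner_self_rightMul, inner_rightMul_rightMul, if_pos rfl, real_inner_self_eq_norm_sq,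
      norm_eq_of_mem_sphere]
    simp [frameDeriv]
  · intro a _ hab
    rw [inner_rightMul_rightMul, if_neg hab.symm, inner_self_rightMul]
    simp
  · simp

end Extensions

/-! ### The frame fields as derivations; linear functions as first harmonics. -/

section FrameDerivations

theorem frameDeriv_frameDeriv (a b : Fin 3) {F : R4 → ℝ} (hF : F ∈ smoothOff) {y : R4}
    (hy : y ≠ 0) : frameDeriv a (frameDeriv b F) y =
      fderiv ℝ (fderiv ℝ F) y (rightMul a y) (rightMul b y) +
        fderiv ℝ F y (rightMul b (rightMul a y)) := by
  have h1 : DifferentiableAt ℝ (fderiv ℝ F) y :=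
    ((contDiffAt_of_mem hF hy).fderiv_right (m := 1) (by norm_cast)).differentiableAt one_ne_zero
  have h2 := h1.hasFDerivAt.clm_apply (rightMul b).hasFDerivAt
  have h3 : fderiv ℝ (frameDeriv b F) y = _ := h2.fderiv
  rw [frameDeriv, h3]
  simp [add_comm]

/-- Second derivatives are symmetric, so only the bracket of the two linear fields remains. -/
theorem frameDeriv_comm (a b : Fin 3) {F : R4 → ℝ} (hF : F ∈ smoothOff) (y : R4) :
    frameDeriv a (frameDeriv b F) y = frameDeriv b (frameDeriv a F) y +
      fderiv ℝ F y (rightMul b (rightMul a y) - rightMul a (rightMul b y)) := by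
  rcases eq_or_ne y 0 with rfl | hy
  · simp [frameDeriv_at_zero]
  have hs : IsSymmSndFDerivAt ℝ F y :=
    (contDiffAt_of_mem hF hy).isSymmSndFDerivAt (by
      rw [minSmoothness_of_isRCLikeNormedField]; exact WithTop.coe_le_coe.2 le_top)
  rw [frameDeriv_frameDeriv a b hF hy, frameDeriv_frameDeriv b a hF hy,
    hs.eq (rightMul a y) (rightMul b y), map_sub]
  ring

/-- Differentiation along the left-invariant frame, as derivations. -/
def frameDerivation (a : Fin 3) : Derivation ℝ smoothOff smoothOff :=
  Derivation.mk'
    { toFun := fun F => ⟨frameDeriv a F, frameDeriv_mem a F.2⟩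
      map_add' := fun F G => by
        ext y
        rcases eq_or_ne y 0 with rfl | hy
        · simp [frameDeriv_at_zero]
        · simp [frameDeriv, fderiv_add (differentiableAt_of_mem F.2 hy)
            (differentiableAt_of_mem G.2 hy)]
      map_smul' := fun c F => by
        ext y
        simp [frameDeriv, fderiv_const_smul_field] }
    (fun F G => by
      ext y
      rcases eq_or_ne y 0 with rfl | hy
      · simp [frameDeriv_at_zero]
      · simp [frameDeriv, fderiv_mul (differentiableAt_of_mem F.2 hy)
            (differentiableAt_of_mem G.2 hy)])

theorem coe_frameDerivation (a : Fin 3) (F : smoothOff) :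
    (frameDerivation a F : R4 → ℝ) = frameDeriv a F := rfl

theorem isSphereFrame_frameDerivation : IsSphereFrame frameDerivation := by
  constructor <;> intro F <;> ext y
  · have h := frameDeriv_comm 0 1 F.2 y
    rw [rightMul_one_zero, rightMul_zero_one, sub_neg_eq_add, ← two_smul ℝ, map_smul] at h
    exact h
  · have h := frameDeriv_comm 1 2 F.2 y
    rw [rightMul_two_one, rightMul_one_two, sub_neg_eq_add, ← two_smul ℝ, map_smul] at h
    exact h
  · have h := frameDeriv_comm 2 0 F.2 y
    rw [rightMul_zero_two, rightMul_two_zero, sub_neg_eq_add, ← two_smul ℝ, map_smul] at h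
    exact h

/-- A linear functional on `ℝ⁴` as a smooth function. -/
def linearFun (l : R4 →L[ℝ] ℝ) : smoothOff := ⟨l, l.contDiff.contDiffOn⟩

theorem frameDerivation_linearFun (a : Fin 3) (l : R4 →L[ℝ] ℝ) :
    frameDerivation a (linearFun l) = linearFun (l.comp (rightMul a)) := by
  ext y
  simp [coe_frameDerivation, frameDeriv, linearFun]

theorem isFirstHarmonic_linearFun (l : R4 →L[ℝ] ℝ) :
    IsFirstHarmonic frameDerivation (linearFun l) := by
  constructor
  case sq =>
    intro a
    simp only [frameDerivation_linearFun]
    ext y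
    simp [linearFun, rightMul_sq]
  all_goals
    simp only [frameDerivation_linearFun]
    ext y
    simp [linearFun, rightMul_one_zero, rightMul_zero_one, rightMul_two_one,
      rightMul_one_two, rightMul_zero_two, rightMul_two_zero]

end FrameDerivations

/-! ### Invariance of the surface measure and integration by parts. -/

section Integration

open MeasureTheory
open scoped Pointwise

/-- The action of a linear isometry of `ℝ⁴` on `S³`. -/
def sphereMap (φ : R4 ≃ₗᵢ[ℝ] R4) (x : S3) : S3 := ⟨φ x, by simp⟩

theorem continuous_sphereMap (φ : R4 ≃ₗᵢ[ℝ] R4) : Continuous (sphereMap φ) :=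
  (φ.continuous.comp continuous_subtype_val).subtype_mk _

theorem measurePreserving_sphereMap (φ : R4 ≃ₗᵢ[ℝ] R4) :
    MeasurePreserving (sphereMap φ) surfaceMeasure surfaceMeasure := by
  have hm : Measurable (sphereMap φ) := (continuous_sphereMap φ).measurable
  refine ⟨hm, Measure.ext fun s hs => ?_⟩
  rw [Measure.map_apply hm hs, surfaceMeasure, Measure.toSphere_apply' _ (hm hs),
    Measure.toSphere_apply' _ hs]
  congr 1
  -- The surface measure of a set is defined by the volume of the cone over it, and a linear
  -- isometry maps cones to cones.
  have hset : Set.Ioo (0 : ℝ) 1 • ((Subtype.val : S3 → R4) '' (sphereMap φ ⁻¹' s)) =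
      φ ⁻¹' (Set.Ioo (0 : ℝ) 1 • ((Subtype.val : S3 → R4) '' s)) := by
    ext y
    simp only [Set.mem_smul, Set.mem_image, Set.mem_preimage]
    constructor
    · rintro ⟨r, hr, _, ⟨x, hx, rfl⟩, rfl⟩
      exact ⟨r, hr, _, ⟨_, hx, rfl⟩, by simp [sphereMap]⟩
    · rintro ⟨r, hr, _, ⟨x, hx, rfl⟩, h⟩
      refine ⟨r, hr, _, ⟨sphereMap φ.symm x, ?_, rfl⟩, ?_⟩
      · have : sphereMap φ (sphereMap φ.symm x) = x := Subtype.ext (by simp [sphereMap])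
        rwa [this]
      · apply φ.injective
        rw [← h]
        simp [sphereMap]
  rw [hset]
  exact φ.measurePreserving.measure_preimage_equiv (f := φ.toMeasurableEquiv) _

/-- The one-parameter group of isometries generated by a field of the left-invariant frame. -/
def rotation (a : Fin 3) (t : ℝ) : R4 ≃ₗᵢ[ℝ] R4 :=
  LinearIsometry.toLinearIsometryEquiv
    -- This is exp(tJ) for J = `rightMul a`, since J² = -1.
    { toLinearMap := Real.cos t • LinearMap.id + Real.sin t • (rightMul a : R4 →ₗ[ℝ] R4)
      norm_map' := fun x => by
        rw [← sq_eq_sq₀ (norm_nonneg _) (norm_nonneg _), ← real_inner_self_eq_norm_sq,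
          ← real_inner_self_eq_norm_sq]
        have h := inner_rightMul_rightMul a a x
        have h' := inner_self_rightMul a x
        have h'' := h'
        rw [real_inner_comm] at h''
        rw [if_pos rfl] at h
        simp only [LinearMap.add_apply, LinearMap.smul_apply, LinearMap.id_apply,
          ContinuousLinearMap.coe_coe, inner_add_left, inner_add_right, inner_smul_left,
          inner_smul_right, h, h', h'', RCLike.conj_to_real]
        linear_combination ⟪x, x⟫ * Real.sin_sq_add_cos_sq t } rfl

theorem rotation_apply (a : Fin 3) (t : ℝ) (x : R4) :
    rotation a t x = Real.cos t • x + Real.sin t • rightMul a x := rfl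

theorem hasDerivAt_rotation (a : Fin 3) (t : ℝ) (x : R4) :
    HasDerivAt (fun s => rotation a s x) (rightMul a (rotation a t x)) t := by
  have h := ((Real.hasDerivAt_cos t).smul_const x).add
    ((Real.hasDerivAt_sin t).smul_const (rightMul a x))
  have he : rightMul a (rotation a t x) = -Real.sin t • x + Real.cos t • rightMul a x := by
    rw [rotation_apply, map_add, map_smul, map_smul, rightMul_sq]
    module
  rw [he]
  exact h

theorem continuous_restrict {F : R4 → ℝ} (hF : F ∈ smoothOff) :
    Continuous (fun x : S3 => F x) := by
  have h : ContinuousOn F {0}ᶜ := ContDiffOn.continuousOn hF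
  exact h.comp_continuous continuous_subtype_val fun x => ne_zero_of_mem_unit_sphere x

instance : IsFiniteMeasure surfaceMeasure := by
  unfold surfaceMeasure; infer_instance

theorem integrable_restrict {F : R4 → ℝ} (hF : F ∈ smoothOff) :
    Integrable (fun x : S3 => F x) surfaceMeasure :=
  (continuous_restrict hF).integrable_of_hasCompactSupport (HasCompactSupport.of_compactSpace _)

/-- The flow of the field preserves the measure, so the integral of F along it is constant in t;
differentiate under the integral at t = 0. -/
theorem integral_frameDeriv (a : Fin 3) {F : R4 → ℝ} (hF : F ∈ smoothOff) :
    ∫ x : S3, frameDeriv a F x ∂surfaceMeasure = 0 := by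
  have hD := continuous_restrict (frameDeriv_mem a hF)
  obtain ⟨C, hC⟩ := isCompact_univ.exists_bound_of_continuousOn hD.continuousOn
  have hcont : ∀ {G : R4 → ℝ}, G ∈ smoothOff → ∀ t, Continuous fun x : S3 => G (rotation a t x) :=
    fun hG t => (continuous_restrict hG).comp (continuous_sphereMap (rotation a t))
  have key := hasDerivAt_integral_of_dominated_loc_of_deriv_le (μ := surfaceMeasure)
    (F := fun t (x : S3) => F (rotation a t x))
    (F' := fun t (x : S3) => frameDeriv a F (rotation a t x)) (x₀ := 0) (s := Set.univ)
    (bound := fun _ => C) Filter.univ_mem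
    (.of_forall fun t => (hcont hF t).aestronglyMeasurable)
    ((hcont hF 0).integrable_of_hasCompactSupport (HasCompactSupport.of_compactSpace _))
    (hcont (frameDeriv_mem a hF) 0).aestronglyMeasurable
    (.of_forall fun x t _ => hC (sphereMap (rotation a t) x) trivial)
    (integrable_const C)
    (.of_forall fun x t _ => by
      have hne : rotation a t x ≠ 0 := ne_zero_of_mem_unit_sphere (sphereMap (rotation a t) x)
      exact (differentiableAt_of_mem hF hne).hasFDerivAt.comp_hasDerivAt t
        (hasDerivAt_rotation a t x))
  have hconst : ∀ t, ∫ x : S3, F (rotation a t x) ∂surfaceMeasure =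
      ∫ x : S3, F x ∂surfaceMeasure := fun t => by
    have hmap := (measurePreserving_sphereMap (rotation a t)).map_eq
    conv_rhs => rw [← hmap]
    rw [integral_map (continuous_sphereMap _).aemeasurable
      (continuous_restrict hF).aestronglyMeasurable]
    rfl
  have h := key.2
  simp only [hconst] at h
  have h0 := h.unique (hasDerivAt_const _ _)
  simpa [rotation_apply] using h0

/-- Integration over `S³`. -/
def sphereIntegral : smoothOff →ₗ[ℝ] ℝ where
  toFun F := ∫ x : S3, (F : R4 → ℝ) x ∂surfaceMeasure
  map_add' F G := integral_add (integrable_restrict F.2) (integrable_restrict G.2)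
  map_smul' c _ := integral_const_mul c _

theorem sphereIntegral_frameDerivation (a : Fin 3) (F : smoothOff) :
    sphereIntegral (frameDerivation a F) = 0 :=
  integral_frameDeriv a F.2

end Integration

/-! ### Smooth radial extension of functions on S³. -/

section Retraction

/-- The radial retraction of `ℝ⁴` onto `S³`, with an arbitrary value at the origin. -/
def retraction (y : R4) : S3 :=
  if h : y = 0 then ⟨EuclideanSpace.single 0 1, by simp⟩
  else ⟨‖y‖⁻¹ • y, by simp [norm_smul, inv_mul_cancel₀ (norm_ne_zero_iff.2 h)]⟩

theorem coe_retraction {y : R4} (hy : y ≠ 0) : (retraction y : R4) = ‖y‖⁻¹ • y := by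
  rw [retraction, dif_neg hy]

theorem retraction_coe (x : S3) : retraction (x : R4) = x := by
  apply Subtype.ext
  rw [coe_retraction (ne_zero_of_mem_unit_sphere x), norm_eq_of_mem_sphere]
  simp

theorem contMDiffOn_retraction : ContMDiffOn 𝓘(ℝ, R4) (𝓡 3) ∞ retraction {0}ᶜ := by
  let U : TopologicalSpace.Opens R4 := ⟨{0}ᶜ, isOpen_compl_singleton⟩
  have hg : ContMDiff 𝓘(ℝ, R4) 𝓘(ℝ, R4) ∞ (fun y : U => ‖(y : R4)‖⁻¹ • (y : R4)) := fun y => by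
    have h : ContMDiffAt 𝓘(ℝ, R4) 𝓘(ℝ, R4) ∞ (fun z : R4 => ‖z‖⁻¹ • z) (y : R4) :=
      (((contDiffAt_norm ℝ y.2).inv (norm_ne_zero_iff.2 y.2)).smul contDiffAt_id).contMDiffAt
    exact contMDiffAt_subtype_iff.2 h
  have hmem : ∀ y : U, ‖(y : R4)‖⁻¹ • (y : R4) ∈ Metric.sphere (0 : R4) 1 := fun y => by
    rw [← coe_retraction y.2]
    exact (retraction y).2
  have hr := hg.codRestrict_sphere (n := 3) hmem
  have heq : Set.codRestrict _ _ hmem = fun y : U => retraction (y : R4) := by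
    funext y
    exact Subtype.ext (coe_retraction y.2).symm
  rw [heq] at hr
  exact fun y hy => (contMDiffAt_subtype_iff.1 (hr ⟨y, hy⟩)).contMDiffWithinAt

/-- The radially constant extension of a smooth function on `S³`. -/
def radialExt (f : S3 → ℝ) (hf : ContMDiff (𝓡 3) 𝓘(ℝ, ℝ) ∞ f) : smoothOff :=
  ⟨f ∘ retraction, (hf.comp_contMDiffOn contMDiffOn_retraction).contDiffOn⟩

theorem radialExt_coe {f : S3 → ℝ} (hf : ContMDiff (𝓡 3) 𝓘(ℝ, ℝ) ∞ f) (x : S3) :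
    f x = (radialExt f hf : R4 → ℝ) x := by
  simp [radialExt, retraction_coe]

end Retraction

/-! ### Dictionary between the operators on S³ and the frame algebra. -/

section KazdanWarner

theorem inner_grad_eq_gradPair {f g : S3 → ℝ} {F G : smoothOff}
    (hf : ∀ x : S3, f x = (F : R4 → ℝ) x) (hg : ∀ x : S3, g x = (G : R4 → ℝ) x) (x : S3) :
    ⟪grad f x, grad g x⟫ = ((gradPair frameDerivation F G : smoothOff) : R4 → ℝ) x := by
  rw [inner_grad_grad hf hg (differentiableAt_of_mem F.2 (ne_zero_of_mem_unit_sphere x))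
    (differentiableAt_of_mem G.2 (ne_zero_of_mem_unit_sphere x)), Fin.sum_univ_three]
  rfl

theorem laplacian_eq_sumSq {f : S3 → ℝ} {F : smoothOff} (hf : ∀ x : S3, f x = (F : R4 → ℝ) x)
    (x : S3) : laplacian f x = ((sumSq frameDerivation F : smoothOff) : R4 → ℝ) x := by
  rw [laplacian_eq hf F.2, Fin.sum_univ_three]
  rfl

theorem paneitz_eq_framePaneitz {f : S3 → ℝ} {F : smoothOff}
    (hf : ∀ x : S3, f x = (F : R4 → ℝ) x) (x : S3) :
    paneitz f x = ((framePaneitz frameDerivation F : smoothOff) : R4 → ℝ) x := by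
  rw [paneitz, laplacian_eq_sumSq (laplacian_eq_sumSq hf), laplacian_eq_sumSq hf, hf x]
  rfl

theorem sphereIntegral_congr {F G : smoothOff}
    (h : ∀ x : S3, (F : R4 → ℝ) x = (G : R4 → ℝ) x) : sphereIntegral F = sphereIntegral G :=
  MeasureTheory.integral_congr_ae (.of_forall h)

end KazdanWarner

end PaneitzSphere

end

open PaneitzSphere in
theorem corollary5p1 (χ ρ : PaneitzSphere.S3 → ℝ)
    (hχ : ContMDiff (𝓡 3) 𝓘(ℝ, ℝ) ∞ χ) (hρ : ContMDiff (𝓡 3) 𝓘(ℝ, ℝ) ∞ ρ)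
    (hχ_pos : ∀ x, 0 < χ x) (hρ_pos : ∀ x, 0 < ρ x)
    (hP : ∀ x, PaneitzSphere.paneitz ρ x = -(χ x * ρ x ^ (-7 : ℤ))) :
    ∀ i : Fin 4,
      ∫ x, ⟪PaneitzSphere.grad χ x, PaneitzSphere.grad (PaneitzSphere.coord i) x⟫
        * ρ x ^ (-6 : ℤ) ∂PaneitzSphere.surfaceMeasure = 0 := by
  intro i
  let r := radialExt ρ hρ
  let c := radialExt χ hχ
  let u := linearFun (EuclideanSpace.proj i)
  have hρ0 : ∀ x, ρ x ≠ 0 := fun x => (hρ_pos x).ne'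
  let s : smoothOff := ⟨fun y => (ρ (retraction y))⁻¹,
    ContDiffOn.inv r.2 fun y _ => hρ0 (retraction y)⟩
  have hrs : r * s = 1 := by
    ext y
    exact mul_inv_cancel₀ (hρ0 (retraction y))
  have hs : ∀ x : S3, (s : R4 → ℝ) x = (ρ x)⁻¹ := fun x =>
    congrArg (fun z => (ρ z)⁻¹) (retraction_coe x)
  have hu := isFirstHarmonic_linearFun (EuclideanSpace.proj i)
  have hE := isSphereFrame_frameDerivation
  have hpair := integral_gradPair_mul_pow sphereIntegral_frameDerivation hu c hrs
  have hzero := integral_conformal_mul_framePaneitz sphereIntegral_frameDerivation hE hu r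
  set q := gradPair frameDerivation u r + (1 / 2 : ℝ) • (u * r)
  -- The equation for ρ is known only on S³, which is all that the integral sees.
  have hcongr : sphereIntegral (q * (c * s ^ 7)) =
      sphereIntegral (-(q * framePaneitz frameDerivation r)) := sphereIntegral_congr fun x => by
    have h := hP x
    rw [paneitz_eq_framePaneitz (radialExt_coe hρ)] at h
    change (q : R4 → ℝ) x * ((c : R4 → ℝ) x * (s : R4 → ℝ) x ^ 7) =
      -((q : R4 → ℝ) x * ((framePaneitz frameDerivation r : smoothOff) : R4 → ℝ) x)
    rw [h, hs, ← radialExt_coe hχ, inv_pow, zpow_neg]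
    norm_cast
    ring
  have hint : sphereIntegral (gradPair frameDerivation u c * s ^ 6) = 0 := by
    rw [hpair, hcongr, map_neg, hzero]
    simp
  rw [← hint]
  refine MeasureTheory.integral_congr_ae (.of_forall fun x => ?_)
  have hx := inner_grad_eq_gradPair (F := u) (fun _ => rfl) (radialExt_coe hχ) x (f := coord i)
  change _ = ((gradPair frameDerivation u c : smoothOff) : R4 → ℝ) x * (s : R4 → ℝ) x ^ 6
  beta_reduce
  rw [real_inner_comm, hx, hs, inv_pow, zpow_neg]
  norm_cast
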